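/- For $\gamma=\begin{pmatrix}a&b\\c&d\end{pmatrix}\in\mathrm{SL}_2(\mathbb{Z})$ with $c\neq 0$ let $\ell_\gamma:=\gcd(c,a-1)$, and let $T_\gamma\subset\mathbb{R}^2$ be the (closed, filled) triangle with vertices $(0,0)$, $(a-1,c)$ and $(-1,0)$. For a triangle $T\subset\mathbb{R}^2$ with vertices in $\mathbb{Q}^2$ and $m\in\mathbb{Z}_{\ge 0}$ let $\mathrm{G}(T,m):=\#(\mathbb{Z}^2\cap mT)$, and let $$\mathrm{G}(T,m)=\mathrm{G}_2(T,m)\,m^2+\mathrm{G}_1(T,m)\,m+\mathrm{G}_0(T,m)\qquad(m\in\mathbb{Z}_{\ge0})$$ be the expression of $\mathrm{G}(T,\cdot)$ as a quasi-polynomial; that is, $\mathrm{G}_i(T,\cdot):\mathbb{Z}_{\ge0}\to\mathbb{R}$ $(i=0,1,2)$ are the unique functions satisfying this identity and $\mathrm{G}_i(T,m+N)=\mathrm{G}_i(T,m)$ for all $m\ge 0$, where $N$ is the smallest positive integer such that $NT$ has its vertices in $\mathbb{Z}^2$. Let $\gamma=\begin{pmatrix}a&b\\c&d\end{pmatrix}$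 and $\gamma'=\begin{pmatrix}a'&b'\\c'&d'\end{pmatrix}$ be in $\mathrm{SL}_2(\mathbb{Z})$ and set $\ell:=\gcd(\ell_\gamma,\ell_{\gamma'})$. If $c$, $c'$ and $ca'+dc'$ are positive, then the coefficients $\mathrm{G}_i$ of the triangles $\ell^{-1}T_\gamma$, $\ell^{-1}T_{\gamma'}$ and $\ell^{-1}T_{\gamma\gamma'}$ exist, and $$\mathrm{G}_0(\ell^{-1}T_{\gamma\gamma'},m)=\mathrm{G}_0(\ell^{-1}T_\gamma,m)+\mathrm{G}_0(\ell^{-1}T_{\gamma'},m)+\{m/\ell\}-1$$ for all $m\in\mathbb{Z}_{\ge 0}$, where $\{y\}:=y-\lfloor y\rfloor$. -/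

import Mathlib

open scoped Pointwise MatrixGroups

namespace EhrhartTriangle

noncomputable section

/-- The points of the lattice `ℤ²` inside `ℝ²`. -/
def latticePoint (z : Fin 2 → ℤ) : Fin 2 → ℝ := fun i => (z i : ℝ)

/-- The lattice point enumerator `G(P, m) = #(ℤ² ∩ m P)`, for a bounded set `P ⊂ ℝ²`. -/
def latticeCount (P : Set (Fin 2 → ℝ)) (m : ℕ) : ℕ :=
  Set.ncard {z : Fin 2 → ℤ | latticePoint z ∈ (m : ℝ) • P}

/-- The denominator of a polygon `P`: the smallest positive integer `d` such that all the vertices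
(extreme points) of `d P` lie in `ℤ²`. (It is `0` if there is no such `d`.) -/
def den (P : Set (Fin 2 → ℝ)) : ℕ :=
  sInf {d : ℕ | 0 < d ∧ ((d : ℝ) • P).extremePoints ℝ ⊆ Set.range latticePoint}

/-- `g 0`, `g 1`, `g 2` are the coefficients of `m ↦ G(P, m)` as a quasi-polynomial of degree at
most `2`: each `g i : ℤ_{≥ 0} → ℝ` has period `den P` (a positive integer), and
`G(P, m) = g 2 m * m ^ 2 + g 1 m * m + g 0 m` for all `m ≥ 0`. -/
structure IsEhrhartCoeffs (P : Set (Fin 2 → ℝ)) (g : Fin 3 → ℕ → ℝ) : Prop where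
  den_pos : 0 < den P
  periodic : ∀ i m, g i (m + den P) = g i m
  expansion : ∀ m : ℕ, (latticeCount P m : ℝ) = g 2 m * (m : ℝ) ^ 2 + g 1 m * (m : ℝ) + g 0 m

/-- The coefficients of the quasi-polynomial are unique. -/
theorem IsEhrhartCoeffs.unique {P : Set (Fin 2 → ℝ)} {g h : Fin 3 → ℕ → ℝ}
    (hg : IsEhrhartCoeffs P g) (hh : IsEhrhartCoeffs P h) : g = h := by
  funext i m
  have hd : (0 : ℝ) < (den P : ℝ) := by exact_mod_cast hg.den_pos
  have e0 := (hg.expansion m).symm.trans (hh.expansion m)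
  have e1 := (hg.expansion (m + den P)).symm.trans (hh.expansion (m + den P))
  have e2 := (hg.expansion (m + den P + den P)).symm.trans (hh.expansion (m + den P + den P))
  simp only [hg.periodic, hh.periodic] at e1 e2
  push_cast at e1 e2
  generalize (den P : ℝ) = d at *
  generalize (m : ℝ) = x at *
  have k2 : g 2 m = h 2 m := by
    have : (2 * d ^ 2) * (g 2 m - h 2 m) = 0 := by linear_combination e2 - 2 * e1 + e0
    have hne : (2 * d ^ 2) ≠ 0 := by positivity
    exact sub_eq_zero.mp ((mul_eq_zero.mp this).resolve_left hne)
  have k1 : g 1 m = h 1 m := by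
    rw [k2] at e0 e1
    have : d * (g 1 m - h 1 m) = 0 := by linear_combination e1 - e0
    exact sub_eq_zero.mp ((mul_eq_zero.mp this).resolve_left hd.ne')
  have k0 : g 0 m = h 0 m := by
    rw [k2, k1] at e0
    linear_combination e0
  fin_cases i
  · exact k0
  · exact k1
  · exact k2

open Classical in
/-- The `i`-th Ehrhart coefficient `G_i(P, m)` of `P` (set to `0` if `G(P, ·)` is not a
quasi-polynomial as above). -/
def ehrhartCoeff (P : Set (Fin 2 → ℝ)) (i : Fin 3) (m : ℕ) : ℝ :=
  if h : ∃ g, IsEhrhartCoeffs P g then h.choose i m else 0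

theorem IsEhrhartCoeffs.ehrhartCoeff_eq {P : Set (Fin 2 → ℝ)} {g : Fin 3 → ℕ → ℝ}
    (hg : IsEhrhartCoeffs P g) : ehrhartCoeff P = g := by
  have h : ∃ g, IsEhrhartCoeffs P g := ⟨g, hg⟩
  funext i m
  rw [ehrhartCoeff, dif_pos h, h.choose_spec.unique hg]

/-- The content `ℓ_γ = gcd(c, a - 1)` of `γ = (a, b; c, d)`. -/
def content (γ : SL(2, ℤ)) : ℕ := Int.gcd (γ 1 0) (γ 0 0 - 1)

/-- The triangle `T_γ` with vertices `(0, 0)`, `(a - 1, c)`, `(-1, 0)`, where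
`γ = (a, b; c, d)` (used for `c ≠ 0`). -/
def triangle (γ : SL(2, ℤ)) : Set (Fin 2 → ℝ) :=
  convexHull ℝ {![0, 0], ![(γ 0 0 : ℝ) - 1, (γ 1 0 : ℝ)], ![-1, 0]}

end

end EhrhartTriangle

namespace EhrhartTriangle


/-! Put e₁ = (1, 0). Translating `(m/ℓ) T_γ'` by (m/ℓ) e₁ gives the triangle (m/ℓ)·(0, e₁, γ'e₁), so
`G(ℓ⁻¹ T_γ', m)` counts its points in the coset L = ℤ² + (m/ℓ) e₁. As ℓ divides c and a - 1, γe₁ ≡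
e₁ mod ℓ, so γ preserves L. The same number therefore counts the points of L in (m/ℓ)·(0, γe₁,
γγ'e₁) (`ncard_shiftedTriangle_smul`).

Slice both triangles into horizontal rows. An edge through 0 in the direction δe₁ contributes the
floor sum F_δ of ⌊ay/c⌋, where (a, c) = δe₁. An edge not through 0 has integral end points after the
shift, so its sum is elementary. Equating the two counts expresses F_γγ' - F_γ - F_γ' in closed form
(`floor_sum_reciprocity`).

The row count also shows that G₁ and G₂ are constant and that F_δ at m mod ℓ is the only
non-elementary part of G₀ (`isEhrhartCoeffs_triangle`). The reciprocity of the F_δ thus becomes the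
asserted relation for G₀. -/

/-! ### Row counts and floor sums along an edge. -/

/-- Counting lattice points of a planar region row by row. -/
theorem ncard_rows (Y : ℕ) (lo hi : ℕ → ℤ) (h : ∀ y ≤ Y, lo y ≤ hi y + 1) (S : Set (ℤ × ℤ))
    (hS : ∀ x y : ℤ, (x, y) ∈ S → 0 ≤ y ∧ y ≤ Y)
    (hS' : ∀ (x : ℤ) (y : ℕ), y ≤ Y → ((x, (y : ℤ)) ∈ S ↔ lo y ≤ x ∧ x ≤ hi y)) :
    (S.ncard : ℤ) = ∑ y ∈ Finset.range (Y + 1), (hi y - lo y + 1) := by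
  have e : S = ((Finset.range (Y + 1)).biUnion
      fun y => (Finset.Icc (lo y) (hi y)).image fun x => (x, (y : ℤ)) : Finset (ℤ × ℤ)) := by
    ext ⟨x, y⟩
    simp only [Finset.coe_biUnion, Set.mem_iUnion, Finset.mem_coe, Finset.mem_image,
      Finset.mem_Icc, Prod.mk.injEq, Finset.mem_range]
    constructor
    · intro hx
      obtain ⟨h0, hY⟩ := hS x y hx
      lift y to ℕ using h0
      have hY' : y ≤ Y := by exact_mod_cast hY
      exact ⟨y, by omega, x, (hS' x y hY').1 hx, rfl, rfl⟩
    · rintro ⟨n, hn, z, hz, rfl, rfl⟩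
      exact (hS' z n (by omega)).2 hz
  rw [e, Set.ncard_coe_finset, Finset.card_biUnion]
  · push_cast
    refine Finset.sum_congr rfl fun y hy => ?_
    rw [Finset.card_image_of_injective _ (fun a b hab => by simpa using hab), Int.card_Icc]
    -- Equality lo = hi + 1 is an empty row, which correctly contributes 0.
    have := h y (by simpa [Nat.lt_succ_iff] using hy)
    omega
  · intro i _ j _ hij
    simp only [Function.onFun, Finset.disjoint_left, Finset.mem_image, Finset.mem_Icc]
    rintro ⟨x, y⟩ ⟨_, _, h1⟩ ⟨_, _, h2⟩
    simp only [Prod.mk.injEq] at h1 h2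
    exact hij (by exact_mod_cast h1.2.trans h2.2.symm)

theorem neg_ediv_add_ediv (n : ℤ) {c : ℤ} (hc : 0 < c) :
    (-n) / c + n / c = if c ∣ n then 0 else -1 := by
  split_ifs with h
  · obtain ⟨k, rfl⟩ := h
    rw [← mul_neg, Int.mul_ediv_cancel_left _ hc.ne', Int.mul_ediv_cancel_left _ hc.ne']
    ring
  · have h1 := Int.emod_add_mul_ediv n c
    have h2 := Int.emod_add_mul_ediv (-n) c
    have h3 := Int.emod_nonneg n hc.ne'
    have h4 := Int.emod_nonneg (-n) hc.ne'
    have h5 := Int.emod_lt_of_pos n hc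
    have h6 := Int.emod_lt_of_pos (-n) hc
    have h7 : n % c ≠ 0 := fun h0 => h (Int.dvd_of_emod_eq_zero h0)
    have h8 : c * ((-n) / c + n / c + 1) = c - n % c - (-n) % c := by linarith
    have h9 : (-n) / c + n / c + 1 < 1 := by
      by_contra hh
      push Not at hh
      have : 0 < n % c := lt_of_le_of_ne h3 (Ne.symm h7)
      nlinarith
    have h10 : -1 < (-n) / c + n / c + 1 := by
      by_contra hh
      push Not at hh
      nlinarith
    omega

/-- With g = gcd(A, C) and C = ge, the condition says e ∣ y, and the range ends at mge. -/
theorem card_dvd_mul_range (A : ℤ) {C : ℕ} (hC : 0 < C) (m : ℕ) :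
    ((Finset.range (m * C + 1)).filter fun y : ℕ => (C : ℤ) ∣ A * y).card
      = m * Int.gcd A C + 1 := by
  set g := Int.gcd A C with hg
  have hgpos : 0 < g := Int.gcd_pos_of_ne_zero_right _ (by exact_mod_cast hC.ne')
  have hgC : g ∣ C := by exact_mod_cast Int.gcd_dvd_right A (C : ℤ)
  obtain ⟨e, he⟩ := hgC
  have hepos : 0 < e := Nat.pos_of_ne_zero (by rintro rfl; omega)
  have key : ∀ y : ℕ, (C : ℤ) ∣ A * y ↔ e ∣ y := by
    intro y
    obtain ⟨B, hB⟩ : (g : ℤ) ∣ A := Int.gcd_dvd_left A (C : ℤ)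
    have hcop : IsCoprime (e : ℤ) B := by
      have := Int.gcd_div_gcd_div_gcd (i := A) (j := (C : ℤ)) (by rw [← hg]; exact hgpos)
      rw [← hg, hB, he] at this
      push_cast at this
      have hg0 : (g : ℤ) ≠ 0 := by exact_mod_cast hgpos.ne'
      rw [Int.mul_ediv_cancel_left _ hg0, Int.mul_ediv_cancel_left _ hg0] at this
      exact (Int.isCoprime_iff_gcd_eq_one.2 this).symm
    have hg0 : (g : ℤ) ≠ 0 := by exact_mod_cast hgpos.ne'
    rw [he, hB, Nat.cast_mul, mul_assoc, mul_dvd_mul_iff_left hg0]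
    exact ⟨fun h => Int.natCast_dvd_natCast.1 (hcop.dvd_of_dvd_mul_left h),
      fun h => dvd_mul_of_dvd_right (Int.natCast_dvd_natCast.2 h) _⟩
  have h2 : ((Finset.range (m * C + 1)).filter fun y : ℕ => (C : ℤ) ∣ A * y)
      = insert 0 ((Finset.Ioc 0 (m * C)).filter fun y => e ∣ y) := by
    ext y
    simp only [Finset.mem_filter, Finset.mem_range, Finset.mem_insert, Finset.mem_Ioc, key]
    rcases Nat.eq_zero_or_pos y with rfl | hy
    · simp
    · constructor
      · rintro ⟨h, h'⟩
        exact Or.inr ⟨⟨hy, by omega⟩, h'⟩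
      · rintro (h | ⟨⟨_, h⟩, h'⟩)
        · omega
        · exact ⟨by omega, h'⟩
  rw [h2, Finset.card_insert_of_notMem (by simp), Nat.Ioc_filter_dvd_card_eq_div]
  congr 1
  rw [he, ← mul_assoc, Nat.mul_div_cancel _ hepos]

theorem sum_range_reflect_succ (n : ℕ) (f : ℤ → ℤ) :
    ∑ y ∈ Finset.range (n + 1), f ((n : ℤ) - y) = ∑ y ∈ Finset.range (n + 1), f y := by
  rw [← Finset.sum_range_reflect (fun y : ℕ => f y)]
  refine Finset.sum_congr rfl fun y hy => ?_
  have : y ≤ n := by simpa [Nat.lt_succ_iff] using hy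
  congr 1
  have : n + 1 - 1 - y = n - y := by omega
  rw [this]
  push_cast [‹y ≤ n›]
  ring

/-- Pairing y with mC - y makes each pair sum to Am - 1, or to Am when C ∣ Ay. For C = 0 the right
side is m (A + |A|), whence A ≤ 0; this case serves a horizontal edge. -/
theorem two_mul_sum_ediv (A : ℤ) (C m : ℕ) (h : 0 < C ∨ A ≤ 0) :
    2 * ∑ y ∈ Finset.range (m * C + 1), A * y / (C : ℤ)
      = A * m * (m * C + 1) - m * C + m * Int.gcd A C := by
  rcases Nat.eq_zero_or_pos C with rfl | hC
  · have hA : A ≤ 0 := by simpa using h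
    have : ((Int.gcd A (0 : ℕ) : ℕ) : ℤ) = -A := by
      simp only [Nat.cast_zero, Int.gcd_zero_right]
      omega
    rw [this]
    simp
    ring
  have hC' : (0 : ℤ) < C := by exact_mod_cast hC
  have hrefl := sum_range_reflect_succ (m * C) (fun z => A * z / (C : ℤ))
  rw [two_mul]
  nth_rewrite 1 [← hrefl]
  rw [← Finset.sum_add_distrib]
  have : ∀ y ∈ Finset.range (m * C + 1), A * (((m * C : ℕ) : ℤ) - y) / (C : ℤ) + A * y / (C : ℤ)
      = (A * m - 1) + if (C : ℤ) ∣ A * y then 1 else 0 := by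
    intro y _
    have e : A * (((m * C : ℕ) : ℤ) - y) = -(A * y) + (A * m) * C := by push_cast; ring
    have := neg_ediv_add_ediv (A * y) hC'
    rw [e, Int.add_mul_ediv_right _ _ hC'.ne']
    split_ifs at this ⊢ <;> linarith
  rw [Finset.sum_congr rfl this, Finset.sum_add_distrib, Finset.sum_const, Finset.card_range,
    Finset.sum_boole, card_dvd_mul_range A hC]
  simp only [nsmul_eq_mul]
  push_cast
  ring

theorem sum_left_edge (l C m : ℕ) (A : ℤ) (hl : 0 < l) (hC : 0 < C) :
    ∑ y ∈ Finset.range (m * C + 1), ((m : ℤ) * C - (1 + l * A) * y) / ((l : ℤ) * C)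
      = -((m * C + 1) * (m * A))
        + ∑ y ∈ Finset.range (m * C + 1), (1 + l * A) * y / ((l : ℤ) * C) := by
  have hc : (l : ℤ) * C ≠ 0 := by positivity
  rw [← sum_range_reflect_succ (m * C)
    (fun z => ((m : ℤ) * C - (1 + l * A) * z) / ((l : ℤ) * C))]
  have : ∀ y ∈ Finset.range (m * C + 1),
      ((m : ℤ) * C - (1 + l * A) * (((m * C : ℕ) : ℤ) - y)) / ((l : ℤ) * C)
      = -(m * A) + (1 + l * A) * y / ((l : ℤ) * C) := by
    intro y _
    have e : ((m : ℤ) * C - (1 + l * A) * (((m * C : ℕ) : ℤ) - y))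
        = (1 + l * A) * y + (-(m * A)) * (l * C) := by push_cast; ring
    rw [e, Int.add_mul_ediv_right _ _ hc]
    ring
  rw [Finset.sum_congr rfl this, Finset.sum_add_distrib, Finset.sum_const, Finset.card_range]
  simp only [nsmul_eq_mul]
  push_cast
  ring

/-- On the right side of an edge through 0 one needs ⌊-t⌋ instead of -⌊t⌋; they differ by 1 unless t
is an integer. Coprimality and m < l leave the end point y = mC as the only point of the shifted
lattice on the edge. -/
theorem sum_right_edge (l C m : ℕ) (A : ℤ) (hC : 0 < C) (hm : m < l)
    (hcop : IsCoprime (1 + l * A) ((l : ℤ) * C)) :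
    ∑ y ∈ Finset.range (m * C + 1), ((1 + l * A) * y - (m : ℤ) * C) / ((l : ℤ) * C)
      = (m * C + 1) * (m * A) - m * C
        - ∑ y ∈ Finset.range (m * C + 1), (1 + l * A) * y / ((l : ℤ) * C) := by
  have hl : 0 < l := by omega
  have hc : 0 < (l : ℤ) * C := by positivity
  have h := sum_left_edge l C m A hl hC
  have hsum : ∀ y ∈ Finset.range (m * C + 1),
      ((1 + l * A) * y - (m : ℤ) * C) / ((l : ℤ) * C)
      = -(((m : ℤ) * C - (1 + l * A) * y) / ((l : ℤ) * C))
        + (if y = m * C then 0 else -1) := by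
    intro y hy
    have hy' : y ≤ m * C := by simpa [Nat.lt_succ_iff] using hy
    have := neg_ediv_add_ediv ((m : ℤ) * C - (1 + l * A) * y) hc
    rw [neg_sub] at this
    have hiff : ((l : ℤ) * C ∣ (m : ℤ) * C - (1 + l * A) * y) ↔ y = m * C := by
      have e : (m : ℤ) * C - (1 + l * A) * y
          = (1 + l * A) * ((m * C : ℕ) - y) + (l * C) * (-(m * A)) := by push_cast; ring
      rw [e, dvd_add_left (dvd_mul_right _ _)]
      constructor
      · intro hd
        replace hd := hcop.symm.dvd_of_dvd_mul_left hd
        have h0 : (0 : ℤ) ≤ (m * C : ℕ) - y := by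
          have : (y : ℤ) ≤ (m * C : ℕ) := by exact_mod_cast hy'
          linarith
        have hlt : ((m * C : ℕ) : ℤ) - y < l * C := by
          have : m * C < l * C := Nat.mul_lt_mul_of_pos_right hm hC
          have : ((m * C : ℕ) : ℤ) < l * C := by exact_mod_cast this
          have : (0 : ℤ) ≤ y := by positivity
          linarith
        have := Int.eq_zero_of_dvd_of_nonneg_of_lt h0 hlt hd
        omega
      · rintro rfl
        simp
    simp only [hiff] at this
    linarith
  rw [Finset.sum_congr rfl hsum, Finset.sum_add_distrib, Finset.sum_neg_distrib, h,
    Finset.sum_range_succ (fun y => if y = m * C then (0 : ℤ) else -1)]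
  have : ∑ y ∈ Finset.range (m * C), (if y = m * C then (0 : ℤ) else -1)
      = ∑ y ∈ Finset.range (m * C), (-1 : ℤ) :=
    Finset.sum_congr rfl fun y hy => by
      rw [if_neg (by have := Finset.mem_range.1 hy; omega)]
  rw [this]
  simp
  ring

/-! ### The shifted triangle counted by rows. -/

/-- The lattice points of the triangle `0, (m/l) v₁, (m/l) v₂` in the lattice
`ℤ² + (m/l) e₁`, where `vᵢ = (aᵢ, cᵢ)`, `cᵢ = l Cᵢ` and `det (v₁, v₂) = l C`. -/
def shiftedTriangle (a₁ c₁ C₁ a₂ c₂ C₂ C m : ℤ) : Set (ℤ × ℤ) :=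
  {p | 0 ≤ a₁ * p.2 - c₁ * p.1 - m * C₁ ∧ 0 ≤ c₂ * p.1 - a₂ * p.2 + m * C₂ ∧
    (a₁ * p.2 - c₁ * p.1 - m * C₁) + (c₂ * p.1 - a₂ * p.2 + m * C₂) ≤ m * C}

theorem ncard_base (l C m : ℕ) (A : ℤ) (hl : 0 < l) (hC : 0 < C) :
    ((shiftedTriangle 1 0 0 (1 + l * A) (l * C) C C m).ncard : ℤ)
      = ∑ y ∈ Finset.range (m * C + 1),
        (A * y / (C : ℤ) + ((m : ℤ) * C - (1 + l * A) * y) / ((l : ℤ) * C) + 1) := by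
  have hl' : (0 : ℤ) < l := by exact_mod_cast hl
  have hC' : (0 : ℤ) < C := by exact_mod_cast hC
  have hc : 0 < (l : ℤ) * C := by positivity
  rw [ncard_rows (m * C) (fun y => -(((m : ℤ) * C - (1 + l * A) * y) / ((l : ℤ) * C)))
    (fun y => A * y / (C : ℤ))]
  · refine Finset.sum_congr rfl fun y _ => by ring
  · intro y hy
    have hy' : (y : ℤ) ≤ m * C := by exact_mod_cast hy
    by_contra! h
    have h1 := Int.lt_ediv_add_one_mul_self (A * y) hC'
    have h2 := Int.lt_ediv_add_one_mul_self ((m : ℤ) * C - (1 + l * A) * y) hc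
    set q := A * y / (C : ℤ)
    set p := ((m : ℤ) * C - (1 + l * A) * y) / ((l : ℤ) * C)
    have h3 : (p + 1) * (l * C) ≤ (-q - 1) * (l * C) :=
      mul_le_mul_of_nonneg_right (by linarith) hc.le
    have h4 := mul_lt_mul_of_pos_left h1 hl'
    nlinarith
  · rintro x y ⟨h1, h2, h3⟩
    push_cast
    simp only at h1 h2 h3
    constructor <;> linarith
  · intro x y hy
    have e1 : -(((m : ℤ) * C - (1 + l * A) * y) / ((l : ℤ) * C)) ≤ x ↔
        0 ≤ l * C * x - (1 + l * A) * y + m * C := by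
      rw [neg_le, Int.le_ediv_iff_mul_le hc]
      constructor <;> intro h <;> linarith
    have e2 : x ≤ A * y / (C : ℤ) ↔ C * x ≤ A * y := by
      rw [Int.le_ediv_iff_mul_le hC', mul_comm]
    have e3 : C * x ≤ A * y ↔ (l : ℤ) * (C * x) ≤ l * (A * y) :=
      (mul_le_mul_iff_right₀ hl').symm
    rw [e1, e2, e3]
    simp only [shiftedTriangle, Set.mem_ofPred_eq]
    constructor
    · rintro ⟨h1, h2, h3⟩
      exact ⟨h2, by linarith⟩
    · rintro ⟨h1, h2⟩
      exact ⟨by simp, h1, by linarith⟩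


theorem sum_ite_le_split (n k : ℕ) (f g : ℕ → ℤ) :
    ∑ y ∈ Finset.range (n + k + 1), (if y ≤ n then f y else g y)
      = ∑ y ∈ Finset.range (n + 1), f y + ∑ y ∈ Finset.range k, g (n + 1 + y) := by
  rw [show n + k + 1 = (n + 1) + k by ring, Finset.sum_range_add]
  congr 1
  · refine Finset.sum_congr rfl fun y hy => if_pos ?_
    simpa [Nat.lt_succ_iff] using hy
  · exact Finset.sum_congr rfl fun y _ => if_neg (by omega)

/-- Here v₂ is at least as high as v₁: the left boundary is the edge to v₂, and the right one
follows the edge to v₁ up to height mC₁, then the edge from v₁ to v₂. -/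
theorem ncard_shiftedTriangle_of_le (l C₁ D C m : ℕ) (A₁ A₂ : ℤ) (hl : 0 < l) (hC₁ : 0 < C₁)
    (hC : 0 < C)
    (hdet : (1 + l * A₁) * (C₁ + D) - (1 + l * A₂) * C₁ = (C : ℤ)) :
    ((shiftedTriangle (1 + l * A₁) (l * C₁) C₁ (1 + l * A₂) (l * (C₁ + D)) (C₁ + D) C m).ncard : ℤ)
      = ∑ y ∈ Finset.range (m * C₁ + 1), ((1 + l * A₁) * y - (m : ℤ) * C₁) / ((l : ℤ) * C₁)
        + (m * D * (m * A₁) + ∑ y ∈ Finset.range (m * D + 1), (A₂ - A₁) * y / (D : ℤ))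
        + ∑ y ∈ Finset.range (m * (C₁ + D) + 1),
          ((m : ℤ) * (C₁ + D : ℕ) - (1 + l * A₂) * y) / ((l : ℤ) * (C₁ + D : ℕ))
        + (m * (C₁ + D) + 1) := by
  have hl' : (0 : ℤ) < l := by exact_mod_cast hl
  have hC' : (0 : ℤ) < C := by exact_mod_cast hC
  have hC₁' : (0 : ℤ) < C₁ := by exact_mod_cast hC₁
  have hD' : (0 : ℤ) ≤ D := by positivity
  have hc₁ : 0 < (l : ℤ) * C₁ := by positivity
  have hc₂ : 0 < (l : ℤ) * (C₁ + D : ℕ) := by positivity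
  have hDpos : ∀ y : ℕ, y ≤ m * (C₁ + D) → ¬ y ≤ m * C₁ → 0 < D := by
    intro y h1 h2
    refine Nat.pos_of_ne_zero ?_
    rintro rfl
    exact h2 (by simpa using h1)
  -- The three edge forms are linearly dependent up to constants. These relations show that two of
  -- the inequalities imply the third on each range of heights, and that 0 ≤ y ≤ m (C₁ + D).
  have key : ∀ x y : ℤ, C₁ * (l * (C₁ + D) * x - (1 + l * A₂) * y + m * (C₁ + D))
      + (C₁ + D) * ((1 + l * A₁) * y - l * C₁ * x - m * C₁) = C * y := by
    intro x y
    linear_combination (y : ℤ) * hdet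
  -- The third edge form is divisible by l, since that edge joins the integral points m (Aᵢ, Cᵢ).
  have key₃ : ∀ x y : ℤ, m * (C : ℤ) - ((1 + l * A₁) * y - l * C₁ * x - m * C₁)
      - (l * (C₁ + D) * x - (1 + l * A₂) * y + m * (C₁ + D))
      = l * ((A₂ - A₁) * (y - m * C₁) - D * (x - m * A₁)) := by
    intro x y
    linear_combination -(m : ℤ) * hdet
  have key₂ : ∀ x y : ℤ, (C₁ + D) * (l * ((A₂ - A₁) * (y - m * C₁) - D * (x - m * A₁)))
      = C * (m * (C₁ + D) - y)
        - D * (l * (C₁ + D) * x - (1 + l * A₂) * y + m * (C₁ + D)) := by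
    intro x y
    linear_combination ((m : ℤ) * (C₁ + D) - y) * hdet
  have f₂_iff : ∀ x y : ℤ, -(((m : ℤ) * (C₁ + D : ℕ) - (1 + l * A₂) * y) / ((l : ℤ) * (C₁ + D : ℕ)))
      ≤ x ↔ 0 ≤ l * (C₁ + D) * x - (1 + l * A₂) * y + m * (C₁ + D) := by
    intro x y
    rw [neg_le, Int.le_ediv_iff_mul_le hc₂]
    push_cast
    constructor <;> intro h <;> linarith
  have f₁_iff : ∀ x y : ℤ, x ≤ ((1 + l * A₁) * y - (m : ℤ) * C₁) / ((l : ℤ) * C₁)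
      ↔ 0 ≤ (1 + l * A₁) * y - l * C₁ * x - m * C₁ := by
    intro x y
    rw [Int.le_ediv_iff_mul_le hc₁]
    constructor <;> intro h <;> linarith
  have f₃_iff : 0 < D → ∀ x y : ℤ, x ≤ m * A₁ + (A₂ - A₁) * ((y : ℤ) - m * C₁) / (D : ℤ)
      ↔ 0 ≤ (A₂ - A₁) * (y - m * C₁) - D * (x - m * A₁) := by
    intro hD x y
    rw [← sub_le_iff_le_add', Int.le_ediv_iff_mul_le (by exact_mod_cast hD)]
    constructor <;> intro h <;> linarith
  rw [ncard_rows (m * (C₁ + D))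
    (fun y => -(((m : ℤ) * (C₁ + D : ℕ) - (1 + l * A₂) * y) / ((l : ℤ) * (C₁ + D : ℕ))))
    (fun y => if y ≤ m * C₁ then ((1 + l * A₁) * y - (m : ℤ) * C₁) / ((l : ℤ) * C₁)
      else m * A₁ + (A₂ - A₁) * ((y : ℤ) - m * C₁) / (D : ℤ))]
  · simp only [sub_neg_eq_add]
    rw [Finset.sum_add_distrib, Finset.sum_add_distrib]
    congr 1
    · congr 1
      rw [mul_add, sum_ite_le_split]
      congr 1
      have : ∀ y ∈ Finset.range (m * D), (m : ℤ) * A₁ + (A₂ - A₁) *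
          (((m * C₁ + 1 + y : ℕ) : ℤ) - m * C₁) / (D : ℤ)
          = m * A₁ + (A₂ - A₁) * ((y + 1 : ℕ) : ℤ) / (D : ℤ) := by
        intro y _
        congr 3
        push_cast
        ring
      rw [Finset.sum_congr rfl this, Finset.sum_add_distrib, Finset.sum_range_succ' _ (m * D)]
      simp
    · simp
  · intro y hy
    have hy' : (y : ℤ) ≤ m * (C₁ + D) := by exact_mod_cast hy
    have hy0 : (0 : ℤ) ≤ y := by positivity
    -- Otherwise x = hi + 1 would violate both the left and the right inequality of its row, against
    -- `key` or `key₂`.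
    by_contra! h
    have h2 := not_le.1 (mt (f₂_iff _ y).2 (not_le.2 h))
    split_ifs at h h2 with hyC
    · have h1 := not_le.1 (mt (f₁_iff _ y).2 (not_le.2 (lt_add_one _)))
      have k := key (((1 + l * A₁) * y - (m : ℤ) * C₁) / ((l : ℤ) * C₁) + 1) y
      have : (0 : ℤ) ≤ C * y := by positivity
      nlinarith
    · have hD := hDpos y hy hyC
      have h1 := not_le.1 (mt (f₃_iff hD _ y).2 (not_le.2 (lt_add_one _)))
      have k := key₂ (m * A₁ + (A₂ - A₁) * ((y : ℤ) - m * C₁) / (D : ℤ) + 1) y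
      have k1 := mul_nonneg hC'.le (sub_nonneg.2 hy')
      have k2 := mul_nonpos_of_nonneg_of_nonpos hD' h2.le
      have k3 := mul_neg_of_pos_of_neg (by linarith : (0 : ℤ) < C₁ + D)
        (mul_neg_of_pos_of_neg hl' h1)
      linarith
  · rintro x y ⟨h1, h2, h3⟩
    simp only at h1 h2 h3
    push_cast
    constructor
    · have k := key x y
      have : 0 ≤ C * y := by rw [← k]; positivity
      exact nonneg_of_mul_nonneg_right this (by positivity)
    · have k := key₂ x y
      rw [← key₃] at k
      have k1 := mul_nonneg hD' h2
      have k2 := mul_nonneg (by linarith : (0 : ℤ) ≤ C₁ + D) (sub_nonneg.2 h3)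
      have : 0 ≤ C * (m * (C₁ + D) - y) := by linarith
      linarith [nonneg_of_mul_nonneg_right this hC']
  · intro x y hy
    rw [f₂_iff]
    simp only [shiftedTriangle, Set.mem_ofPred_eq]
    have k := key x y
    split_ifs with hyC
    · have hyC' : (y : ℤ) ≤ m * C₁ := by exact_mod_cast hyC
      rw [f₁_iff]
      refine ⟨fun h => ⟨h.2.1, h.1⟩, fun h => ⟨h.2, h.1, ?_⟩⟩
      refine le_of_mul_le_mul_left ?_ hC₁'
      have := mul_nonneg hD' h.2
      have := mul_le_mul_of_nonneg_left hyC' hC'.le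
      linarith
    · have hD := hDpos y hy hyC
      have hyC' : (m : ℤ) * C₁ ≤ y := by exact_mod_cast (not_le.1 hyC).le
      have h₃ := mul_nonneg_iff_of_pos_left (b := (A₂ - A₁) * (y - m * C₁) - D * (x - m * A₁)) hl'
      rw [← key₃] at h₃
      rw [f₃_iff hD, ← h₃]
      refine ⟨fun h => ⟨h.2.1, by linarith [h.2.2]⟩, fun h => ⟨?_, h.1, by linarith [h.2]⟩⟩
      refine nonneg_of_mul_nonneg_right ?_ (Int.natCast_pos.2 hD)
      have := mul_le_mul_of_nonneg_left hyC' hC'.le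
      have := mul_nonneg hC₁'.le h.2
      linarith


/-- The mirror case: v₁ is at least as high as v₂, so the left boundary is the broken one. -/
theorem ncard_shiftedTriangle_of_ge (l C₂ D C m : ℕ) (A₁ A₂ : ℤ) (hl : 0 < l) (hC₂ : 0 < C₂)
    (hC : 0 < C)
    (hdet : (1 + l * A₁) * C₂ - (1 + l * A₂) * (C₂ + D) = (C : ℤ)) :
    ((shiftedTriangle (1 + l * A₁) (l * (C₂ + D)) (C₂ + D) (1 + l * A₂) (l * C₂) C₂ C m).ncard : ℤ)
      = ∑ y ∈ Finset.range (m * (C₂ + D) + 1),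
          ((1 + l * A₁) * y - (m : ℤ) * (C₂ + D : ℕ)) / ((l : ℤ) * (C₂ + D : ℕ))
        + (∑ y ∈ Finset.range (m * C₂ + 1), ((m : ℤ) * C₂ - (1 + l * A₂) * y) / ((l : ℤ) * C₂)
        + (m * D * (-(m * A₂)) + ∑ y ∈ Finset.range (m * D + 1), (A₂ - A₁) * y / (D : ℤ)))
        + (m * (C₂ + D) + 1) := by
  have hl' : (0 : ℤ) < l := by exact_mod_cast hl
  have hC' : (0 : ℤ) < C := by exact_mod_cast hC
  have hC₂' : (0 : ℤ) < C₂ := by exact_mod_cast hC₂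
  have hD' : (0 : ℤ) ≤ D := by positivity
  have hc₂ : 0 < (l : ℤ) * C₂ := by positivity
  have hc₁ : 0 < (l : ℤ) * (C₂ + D : ℕ) := by positivity
  have hDpos : ∀ y : ℕ, y ≤ m * (C₂ + D) → ¬ y ≤ m * C₂ → 0 < D := by
    intro y h1 h2
    refine Nat.pos_of_ne_zero ?_
    rintro rfl
    exact h2 (by simpa using h1)
  have key : ∀ x y : ℤ, (C₂ + D) * (l * C₂ * x - (1 + l * A₂) * y + m * C₂)
      + C₂ * ((1 + l * A₁) * y - l * (C₂ + D) * x - m * (C₂ + D)) = C * y := by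
    intro x y
    linear_combination (y : ℤ) * hdet
  have key₃ : ∀ x y : ℤ, m * (C : ℤ) - ((1 + l * A₁) * y - l * (C₂ + D) * x - m * (C₂ + D))
      - (l * C₂ * x - (1 + l * A₂) * y + m * C₂)
      = l * ((A₂ - A₁) * (y - m * C₂) + D * (x - m * A₂)) := by
    intro x y
    linear_combination -(m : ℤ) * hdet
  have key₂ : ∀ x y : ℤ, (C₂ + D) * (l * ((A₂ - A₁) * (y - m * C₂) + D * (x - m * A₂)))
      = C * (m * (C₂ + D) - y)
        - D * ((1 + l * A₁) * y - l * (C₂ + D) * x - m * (C₂ + D)) := by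
    intro x y
    linear_combination ((m : ℤ) * (C₂ + D) - y) * hdet
  have f₂_iff : ∀ x y : ℤ, -(((m : ℤ) * C₂ - (1 + l * A₂) * y) / ((l : ℤ) * C₂))
      ≤ x ↔ 0 ≤ l * C₂ * x - (1 + l * A₂) * y + m * C₂ := by
    intro x y
    rw [neg_le, Int.le_ediv_iff_mul_le hc₂]
    constructor <;> intro h <;> linarith
  have f₁_iff : ∀ x y : ℤ,
      x ≤ ((1 + l * A₁) * y - (m : ℤ) * (C₂ + D : ℕ)) / ((l : ℤ) * (C₂ + D : ℕ))
      ↔ 0 ≤ (1 + l * A₁) * y - l * (C₂ + D) * x - m * (C₂ + D) := by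
    intro x y
    rw [Int.le_ediv_iff_mul_le hc₁]
    push_cast
    constructor <;> intro h <;> linarith
  have f₃_iff : 0 < D → ∀ x y : ℤ, -(-(m * A₂) + (A₂ - A₁) * ((y : ℤ) - m * C₂) / (D : ℤ)) ≤ x
      ↔ 0 ≤ (A₂ - A₁) * (y - m * C₂) + D * (x - m * A₂) := by
    intro hD x y
    rw [neg_le, ← sub_le_iff_le_add', Int.le_ediv_iff_mul_le (by exact_mod_cast hD)]
    constructor <;> intro h <;> linarith
  rw [ncard_rows (m * (C₂ + D))
    (fun y => -(if y ≤ m * C₂ then ((m : ℤ) * C₂ - (1 + l * A₂) * y) / ((l : ℤ) * C₂)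
      else -(m * A₂) + (A₂ - A₁) * ((y : ℤ) - m * C₂) / (D : ℤ)))
    (fun y => ((1 + l * A₁) * y - (m : ℤ) * (C₂ + D : ℕ)) / ((l : ℤ) * (C₂ + D : ℕ)))]
  · simp only [sub_neg_eq_add]
    rw [Finset.sum_add_distrib, Finset.sum_add_distrib]
    congr 1
    · congr 1
      rw [mul_add, sum_ite_le_split]
      congr 1
      have : ∀ y ∈ Finset.range (m * D), -((m : ℤ) * A₂) + (A₂ - A₁) *
          (((m * C₂ + 1 + y : ℕ) : ℤ) - m * C₂) / (D : ℤ)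
          = -(m * A₂) + (A₂ - A₁) * ((y + 1 : ℕ) : ℤ) / (D : ℤ) := by
        intro y _
        congr 3
        push_cast
        ring
      rw [Finset.sum_congr rfl this, Finset.sum_add_distrib, Finset.sum_range_succ' _ (m * D)]
      simp
    · simp
  · intro y hy
    have hy' : (y : ℤ) ≤ m * (C₂ + D) := by exact_mod_cast hy
    by_contra! h
    have h1 := not_le.1 (mt (f₁_iff _ y).2 (not_le.2 (lt_add_one _)))
    split_ifs at h with hyC
    · have h2 := not_le.1 (mt (f₂_iff _ y).2 (not_le.2 h))
      have k := key (((1 + l * A₁) * y - (m : ℤ) * (C₂ + D : ℕ)) / ((l : ℤ) * (C₂ + D : ℕ)) + 1) y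
      have k0 : (0 : ℤ) ≤ C * y := by positivity
      have k1 := mul_neg_of_pos_of_neg (by linarith : (0 : ℤ) < C₂ + D) h2
      have k2 := mul_neg_of_pos_of_neg hC₂' h1
      linarith
    · have hD := hDpos y hy hyC
      have h2 := not_le.1 (mt (f₃_iff hD _ y).2 (not_le.2 h))
      have k := key₂ (((1 + l * A₁) * y - (m : ℤ) * (C₂ + D : ℕ)) / ((l : ℤ) * (C₂ + D : ℕ)) + 1) y
      have k1 := mul_nonneg hC'.le (sub_nonneg.2 hy')
      have k2 := mul_nonpos_of_nonneg_of_nonpos hD' h1.le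
      have k3 := mul_neg_of_pos_of_neg (by linarith : (0 : ℤ) < C₂ + D)
        (mul_neg_of_pos_of_neg hl' h2)
      linarith
  · rintro x y ⟨h1, h2, h3⟩
    simp only at h1 h2 h3
    push_cast
    constructor
    · have k := key x y
      have : 0 ≤ C * y := by rw [← k]; positivity
      exact nonneg_of_mul_nonneg_right this (by positivity)
    · have k := key₂ x y
      rw [← key₃] at k
      have k1 := mul_nonneg hD' h1
      have k2 := mul_nonneg (by linarith : (0 : ℤ) ≤ C₂ + D) (sub_nonneg.2 h3)
      have : 0 ≤ C * (m * (C₂ + D) - y) := by linarith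
      linarith [nonneg_of_mul_nonneg_right this hC']
  · intro x y hy
    rw [f₁_iff]
    simp only [shiftedTriangle, Set.mem_ofPred_eq]
    have k := key x y
    split_ifs with hyC
    · have hyC' : (y : ℤ) ≤ m * C₂ := by exact_mod_cast hyC
      rw [f₂_iff]
      refine ⟨fun h => ⟨h.2.1, h.1⟩, fun h => ⟨h.2, h.1, ?_⟩⟩
      refine le_of_mul_le_mul_left ?_ hC₂'
      have := mul_nonneg hD' h.1
      have := mul_le_mul_of_nonneg_left hyC' hC'.le
      linarith
    · have hD := hDpos y hy hyC
      have hyC' : (m : ℤ) * C₂ ≤ y := by exact_mod_cast (not_le.1 hyC).le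
      have h₃ := mul_nonneg_iff_of_pos_left (b := (A₂ - A₁) * (y - m * C₂) + D * (x - m * A₂)) hl'
      rw [← key₃] at h₃
      rw [f₃_iff hD, ← h₃]
      refine ⟨fun h => ⟨by linarith [h.2.2], h.1⟩, fun h => ⟨h.2, ?_, by linarith [h.1]⟩⟩
      refine nonneg_of_mul_nonneg_right ?_ (Int.natCast_pos.2 hD)
      have := mul_le_mul_of_nonneg_left hyC' hC'.le
      have := mul_nonneg hC₂'.le h.1
      linarith


/-! ### Unimodular invariance and reciprocity. -/

theorem gcd_unimodular (α β γ δ x y : ℤ) (h : α * δ - β * γ = 1) :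
    Int.gcd (α * x + β * y) (γ * x + δ * y) = Int.gcd x y := by
  refine Nat.dvd_antisymm (Int.dvd_gcd ?_ ?_) (Int.dvd_gcd ?_ ?_)
  · have := ((Int.gcd_dvd_left (α * x + β * y) (γ * x + δ * y)).mul_left δ).sub
      ((Int.gcd_dvd_right (α * x + β * y) (γ * x + δ * y)).mul_left β)
    rwa [show δ * (α * x + β * y) - β * (γ * x + δ * y) = x by
      linear_combination x * h] at this
  · have := ((Int.gcd_dvd_right (α * x + β * y) (γ * x + δ * y)).mul_left α).sub
      ((Int.gcd_dvd_left (α * x + β * y) (γ * x + δ * y)).mul_left γ)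
    rwa [show α * (γ * x + δ * y) - γ * (α * x + β * y) = y by
      linear_combination y * h] at this
  · exact ((Int.gcd_dvd_left x y).mul_left α).add ((Int.gcd_dvd_right x y).mul_left β)
  · exact ((Int.gcd_dvd_left x y).mul_left γ).add ((Int.gcd_dvd_right x y).mul_left δ)

/-- In shifted coordinates γ acts as p ↦ γp + (m/l)(γe₁ - e₁). The translation is the integral
vector m (A₁, C₁), so this is a bijection of ℤ². -/
theorem ncard_shiftedTriangle_smul (l A₁ C₁ A C b d m A₂ C₂ : ℤ)
    (hdet : (1 + l * A₁) * d - b * (l * C₁) = 1)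
    (hA₂ : A₂ = A₁ + A + l * A₁ * A + b * C) (hC₂ : C₂ = C₁ * (1 + l * A) + d * C) :
    (shiftedTriangle (1 + l * A₁) (l * C₁) C₁ (1 + l * A₂) (l * C₂) C₂ C m).ncard
      = (shiftedTriangle 1 0 0 (1 + l * A) (l * C) C C m).ncard := by
  set φ : ℤ × ℤ → ℤ × ℤ := fun p =>
    ((1 + l * A₁) * p.1 + b * p.2 + m * A₁, l * C₁ * p.1 + d * p.2 + m * C₁) with hφ
  set ψ : ℤ × ℤ → ℤ × ℤ := fun p =>
    (d * (p.1 - m * A₁) - b * (p.2 - m * C₁),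
      (1 + l * A₁) * (p.2 - m * C₁) - l * C₁ * (p.1 - m * A₁)) with hψ
  have hψφ : Function.LeftInverse ψ φ := by
    rintro ⟨x, y⟩
    simp only [hφ, hψ, Prod.mk.injEq]
    constructor
    · linear_combination x * hdet
    · linear_combination y * hdet
  have hφψ : Function.RightInverse ψ φ := by
    rintro ⟨x, y⟩
    simp only [hφ, hψ, Prod.mk.injEq]
    constructor
    · linear_combination (x - m * A₁) * hdet
    · linear_combination (y - m * C₁) * hdet
  rw [← Set.ncard_image_of_injective (shiftedTriangle 1 0 0 _ _ _ _ _) hψφ.injective]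
  congr 1
  rw [Set.image_eq_preimage_of_inverse hψφ hφψ]
  ext ⟨x, y⟩
  simp only [shiftedTriangle, hψ, Set.mem_preimage, Set.mem_ofPred_eq]
  have e1 : 1 * ((1 + l * A₁) * (y - m * C₁) - l * C₁ * (x - m * A₁))
      - 0 * (d * (x - m * A₁) - b * (y - m * C₁)) - m * 0
      = (1 + l * A₁) * y - l * C₁ * x - m * C₁ := by ring
  have e2 : l * C * (d * (x - m * A₁) - b * (y - m * C₁))
      - (1 + l * A) * ((1 + l * A₁) * (y - m * C₁) - l * C₁ * (x - m * A₁)) + m * C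
      = l * C₂ * x - (1 + l * A₂) * y + m * C₂ := by
    rw [hA₂, hC₂]
    linear_combination (-m * C) * hdet
  rw [e1, e2]

/-- The reciprocity law for floor sums obtained by slicing a triangle in two directions. -/
theorem floor_sum_reciprocity (l C₁ C C₂ m : ℕ) (A₁ A b d A₂ : ℤ) (hm : m < l)
    (hC₁ : 0 < C₁) (hC : 0 < C) (hC₂pos : 0 < C₂)
    (hdet : (1 + l * A₁) * d - b * (l * C₁) = 1)
    (hA₂ : A₂ = A₁ + A + l * A₁ * A + b * C) (hC₂ : (C₂ : ℤ) = C₁ * (1 + l * A) + d * C) :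
    2 * (∑ y ∈ Finset.range (m * C₂ + 1), (1 + l * A₂) * y / ((l : ℤ) * C₂)
        - ∑ y ∈ Finset.range (m * C₁ + 1), (1 + l * A₁) * y / ((l : ℤ) * C₁)
        - ∑ y ∈ Finset.range (m * C + 1), (1 + l * A) * y / ((l : ℤ) * C))
      = -(A * m * (m * C + 1)) + m * C + 2 * ((m * C₂ + 1) * (m * (A₂ - A₁)))
        - ((A₂ - A₁) * m * (m * (C₂ - C₁) + 1) + m * (C₂ - C₁)) := by
  have hl : 0 < l := by omega
  have hdet' : (1 + l * A₁) * C₂ - (1 + l * A₂) * C₁ = (C : ℤ) := by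
    rw [hA₂, hC₂]
    linear_combination (C : ℤ) * hdet
  have hcop : IsCoprime (1 + l * A₁) ((l : ℤ) * C₁) := ⟨d, -b, by linear_combination hdet⟩
  have hN := ncard_shiftedTriangle_smul l A₁ C₁ A C b d m A₂ C₂ hdet hA₂ hC₂
  replace hN : ((shiftedTriangle (1 + l * A₁) (l * C₁) C₁ (1 + l * A₂) (l * C₂) C₂ C m).ncard : ℤ)
      = (shiftedTriangle 1 0 0 (1 + l * A) (l * C) C C m).ncard := by exact_mod_cast hN
  rw [ncard_base l C m A hl hC, Finset.sum_add_distrib, Finset.sum_add_distrib,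
    sum_left_edge l C m A hl hC] at hN
  have hE := two_mul_sum_ediv A C m (Or.inl hC)
  -- (A₂ - A₁, C₂ - C₁) is the image of (A, C) under γ, so the gcd terms of the two elementary edges
  -- cancel.
  have hg : Int.gcd (A₂ - A₁) (C₂ - C₁) = Int.gcd A C := by
    rw [← gcd_unimodular (1 + l * A₁) b (l * C₁) d A C (by linear_combination hdet)]
    congr 1
    · linear_combination hA₂
    · linear_combination hC₂
  -- By positivity of the determinant a horizontal third edge runs leftwards from v₁ to v₂.
  have hneg : (C₂ : ℤ) - C₁ = 0 → A₂ - A₁ ≤ 0 := by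
    intro h0
    have h1 : (l : ℤ) * C₁ * (A₁ - A₂) = C := by
      linear_combination hdet' - (1 + l * A₁) * h0
    have h2 : (0 : ℤ) < l * C₁ * (A₁ - A₂) := by rw [h1]; exact_mod_cast hC
    have := pos_of_mul_pos_right h2 (by positivity)
    linarith
  rcases le_total C₁ C₂ with hle | hle
  · obtain ⟨D, rfl⟩ := Nat.exists_eq_add_of_le hle
    push_cast at hdet' hg hneg
    rw [add_sub_cancel_left] at hg hneg
    have hED := two_mul_sum_ediv (A₂ - A₁) D m (by
      rcases Nat.eq_zero_or_pos D with h | h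
      · exact Or.inr (hneg (by simp [h]))
      · exact Or.inl h)
    rw [hg] at hED
    have hS := ncard_shiftedTriangle_of_le l C₁ D C m A₁ A₂ hl hC₁ hC hdet'
    rw [← Nat.cast_add, hN, sum_right_edge l C₁ m A₁ hC₁ hm hcop,
      sum_left_edge l (C₁ + D) m A₂ hl hC₂pos] at hS
    simp only [Finset.sum_const, Finset.card_range, nsmul_eq_mul] at hS
    push_cast at hS ⊢
    linear_combination -2 * hS + hE - hED
  · obtain ⟨D, rfl⟩ := Nat.exists_eq_add_of_le hle
    push_cast at hdet' hg hneg
    rw [sub_add_cancel_left] at hg hneg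
    rw [Int.gcd_neg] at hg
    have hED := two_mul_sum_ediv (A₂ - A₁) D m (by
      rcases Nat.eq_zero_or_pos D with h | h
      · exact Or.inr (hneg (by simp [h]))
      · exact Or.inl h)
    rw [hg] at hED
    have hS := ncard_shiftedTriangle_of_ge l C₂ D C m A₁ A₂ hl hC₂pos hC hdet'
    rw [← Nat.cast_add, hN, sum_right_edge l (C₂ + D) m A₁ hC₁ hm hcop,
      sum_left_edge l C₂ m A₂ hl hC₂pos] at hS
    simp only [Finset.sum_const, Finset.card_range, nsmul_eq_mul] at hS
    push_cast at hS ⊢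
    linear_combination -2 * hS + hE - hED


/-! ### Inequalities and denominator of the triangle. -/

theorem triangle_eq_of_pos (δ : SL(2, ℤ)) (hc : 0 < δ 1 0) :
    triangle δ = {p | 0 ≤ p 1 ∧ (δ 1 0 : ℝ) * p 0 ≤ (δ 0 0 - 1) * p 1 ∧
      (δ 0 0 : ℝ) * p 1 - δ 1 0 * p 0 ≤ δ 1 0} := by
  have hc' : (0 : ℝ) < δ 1 0 := by exact_mod_cast hc
  apply Set.Subset.antisymm
  · refine convexHull_min ?_ ?_
    · rintro p (rfl | rfl | rfl)
      · simp [hc'.le]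
      · refine ⟨by simpa using hc'.le, ?_, ?_⟩ <;> simp <;> linarith
      · simp [hc'.le]
    · rintro p ⟨h1, h2, h3⟩ q ⟨k1, k2, k3⟩ s t hs ht hst
      simp only [Set.mem_ofPred_eq, Pi.add_apply, Pi.smul_apply, smul_eq_mul]
      refine ⟨by positivity, ?_, ?_⟩
      · linarith [mul_le_mul_of_nonneg_left h2 hs, mul_le_mul_of_nonneg_left k2 ht]
      · have e : (δ 1 0 : ℝ) = s * δ 1 0 + t * δ 1 0 := by rw [← add_mul, hst, one_mul]
        linarith [mul_le_mul_of_nonneg_left h3 hs, mul_le_mul_of_nonneg_left k3 ht]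
  · rintro p ⟨h1, h2, h3⟩
    have hconv := convex_convexHull ℝ
      ({![0, 0], ![(δ 0 0 : ℝ) - 1, (δ 1 0 : ℝ)], ![-1, 0]} : Set (Fin 2 → ℝ))
    have hsub := subset_convexHull ℝ
      ({![0, 0], ![(δ 0 0 : ℝ) - 1, (δ 1 0 : ℝ)], ![-1, 0]} : Set (Fin 2 → ℝ))
    -- The weights are the barycentric coordinates of p.
    have hmem := hconv.sum_mem (t := Finset.univ)
      (w := ![1 - p 1 / δ 1 0 - ((δ 0 0 - 1) * p 1 - δ 1 0 * p 0) / δ 1 0, p 1 / δ 1 0,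
        ((δ 0 0 - 1) * p 1 - δ 1 0 * p 0) / δ 1 0])
      (z := ![![0, 0], ![(δ 0 0 : ℝ) - 1, (δ 1 0 : ℝ)], ![-1, 0]]) ?_ ?_ ?_
    · rw [triangle]
      convert hmem using 1
      ext i
      rw [Fin.sum_univ_three]
      fin_cases i
      · simp
        field_simp
        ring
      · simp
        field_simp
    · intro i _
      fin_cases i
      · have : p 1 / δ 1 0 + ((δ 0 0 - 1) * p 1 - δ 1 0 * p 0) / δ 1 0 ≤ 1 := by
          rw [← add_div, div_le_one hc']
          linarith
        simp
        linarith
      · simp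
        positivity
      · exact div_nonneg (by linarith) hc'.le
    · rw [Fin.sum_univ_three]
      simp
      ring
    · intro i _
      fin_cases i
      · exact hsub (by simp)
      · exact hsub (by simp)
      · exact hsub (by simp)

theorem mem_smul_triangle (δ : SL(2, ℤ)) (hc : 0 < δ 1 0) {t : ℝ} (ht : 0 ≤ t) (p : Fin 2 → ℝ) :
    p ∈ t • triangle δ ↔ 0 ≤ p 1 ∧ (δ 1 0 : ℝ) * p 0 ≤ (δ 0 0 - 1) * p 1 ∧
      (δ 0 0 : ℝ) * p 1 - δ 1 0 * p 0 ≤ t * δ 1 0 := by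
  have hc' : (0 : ℝ) < δ 1 0 := by exact_mod_cast hc
  rcases ht.eq_or_lt with rfl | ht
  · have hne : (triangle δ).Nonempty :=
      ⟨![0, 0], subset_convexHull ℝ _ (by simp)⟩
    rw [Set.zero_smul_set hne, Set.mem_zero]
    constructor
    · rintro rfl
      simp
    · rintro ⟨h1, h2, h3⟩
      have h4 : p 1 = 0 := by linarith
      rw [h4] at h2 h3
      have h5 : (δ 1 0 : ℝ) * p 0 = 0 := by linarith
      ext i
      fin_cases i
      · exact (mul_eq_zero.1 h5).resolve_left hc'.ne'
      · exact h4
  · rw [Set.mem_smul_set_iff_inv_smul_mem₀ ht.ne', triangle_eq_of_pos δ hc]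
    simp only [Set.mem_ofPred_eq, Pi.smul_apply, smul_eq_mul]
    refine and_congr ?_ (and_congr ?_ ?_)
    · exact mul_nonneg_iff_of_pos_left (inv_pos.2 ht)
    · rw [mul_left_comm, mul_left_comm _ t⁻¹, mul_le_mul_iff_right₀ (inv_pos.2 ht)]
    · rw [mul_left_comm, mul_left_comm _ t⁻¹, ← mul_sub, inv_mul_le_iff₀ ht]

theorem latticeCount_triangle (δ : SL(2, ℤ)) (l C : ℕ) (A : ℤ) (hl : 0 < l) (hC : 0 < C)
    (ha : δ 0 0 = 1 + l * A) (hc : δ 1 0 = l * C) (m : ℕ) :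
    latticeCount ((l : ℝ)⁻¹ • triangle δ) m
      = (shiftedTriangle 1 0 0 (1 + l * A) (l * C) C C m).ncard := by
  have hcpos : 0 < δ 1 0 := by rw [hc]; positivity
  have hl' : (l : ℝ) ≠ 0 := by positivity
  rw [latticeCount, ← Set.ncard_image_of_injective _ (finTwoArrowEquiv ℤ).injective,
    Equiv.image_eq_preimage_symm]
  congr 1
  ext ⟨x, y⟩
  simp only [Set.mem_preimage, Set.mem_ofPred_eq, smul_smul]
  rw [mem_smul_triangle δ hcpos (by positivity)]
  simp only [shiftedTriangle, latticePoint, finTwoArrowEquiv_symm_apply, Matrix.cons_val_zero,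
    Matrix.cons_val_one, Set.mem_ofPred_eq, ha, hc]
  have e : (m : ℝ) * (l : ℝ)⁻¹ * ((l * C : ℤ) : ℝ) = ((m * C : ℤ) : ℝ) := by
    push_cast
    field_simp
  rw [e]
  norm_cast
  constructor
  · rintro ⟨h1, h2, h3⟩
    push_cast at h1 h2 h3 ⊢
    refine ⟨by linarith, by linarith, by linarith⟩
  · rintro ⟨h1, h2, h3⟩
    push_cast at h1 h2 h3 ⊢
    refine ⟨by linarith, by linarith, by linarith⟩

theorem den_triangle (δ : SL(2, ℤ)) (l C : ℕ) (hl : 0 < l) (hC : 0 < C)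
    (hc : δ 1 0 = l * C) :
    den ((l : ℝ)⁻¹ • triangle δ) = l := by
  have hcpos : 0 < δ 1 0 := by rw [hc]; positivity
  have hcpos' : (0 : ℝ) < δ 1 0 := by exact_mod_cast hcpos
  have hl' : (l : ℝ) ≠ 0 := by positivity
  refine (IsLeast.csInf_eq ⟨⟨hl, ?_⟩, ?_⟩)
  · rw [smul_inv_smul₀ hl', triangle]
    refine extremePoints_convexHull_subset.trans ?_
    rintro p (rfl | rfl | rfl)
    · exact ⟨![0, 0], by ext i; fin_cases i <;> simp [latticePoint]⟩
    · exact ⟨![δ 0 0 - 1, δ 1 0], by ext i; fin_cases i <;> simp [latticePoint]⟩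
    · exact ⟨![-1, 0], by ext i; fin_cases i <;> simp [latticePoint]⟩
  · rintro n ⟨hn, hsub⟩
    have ht : (0 : ℝ) ≤ n * (l : ℝ)⁻¹ := by positivity
    -- The multiple of the vertex (-1, 0) alone forces l ∣ n.
    have hext : ![-(n * (l : ℝ)⁻¹), 0] ∈ ((n : ℝ) • (l : ℝ)⁻¹ • triangle δ).extremePoints ℝ := by
      rw [smul_smul, mem_extremePoints_iff_left]
      simp only [mem_smul_triangle δ hcpos ht]
      refine ⟨by simp; constructor <;> nlinarith, ?_⟩
      rintro p ⟨p1, p2, p3⟩ q ⟨q1, q2, q3⟩ ⟨u, v, hu, hv, huv, hpq⟩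
      have h0 := congr_fun hpq 0
      have h1 := congr_fun hpq 1
      simp only [Pi.add_apply, Pi.smul_apply, smul_eq_mul, Matrix.cons_val_zero,
        Matrix.cons_val_one] at h0 h1
      generalize (n : ℝ) * (l : ℝ)⁻¹ = t at *
      have hup : u * p 1 = 0 := by nlinarith [mul_nonneg hu.le p1, mul_nonneg hv.le q1]
      have hvq : v * q 1 = 0 := by linarith
      have hp1 : p 1 = 0 := (mul_eq_zero.1 hup).resolve_left hu.ne'
      have hq1 : q 1 = 0 := (mul_eq_zero.1 hvq).resolve_left hv.ne'
      rw [hp1] at p3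
      rw [hq1] at q3
      have hp0 : -t ≤ p 0 := by
        refine le_of_mul_le_mul_left ?_ hcpos'
        linarith
      have hq0 : -t ≤ q 0 := by
        refine le_of_mul_le_mul_left ?_ hcpos'
        linarith
      have hp0' : p 0 ≤ -t := by
        refine le_of_mul_le_mul_left ?_ hu
        have : v = 1 - u := by linarith
        have := mul_le_mul_of_nonneg_left hq0 hv.le
        subst ‹v = 1 - u›
        linarith
      ext i
      fin_cases i
      · exact le_antisymm hp0' hp0
      · exact hp1
    obtain ⟨z, hz⟩ := hsub hext
    have hz0 := congr_fun hz 0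
    simp only [latticePoint, Matrix.cons_val_zero] at hz0
    have hnl : (n : ℤ) = l * (-z 0) := by
      have : (n : ℝ) = l * (-z 0) := by rw [hz0]; field_simp
      exact_mod_cast this
    exact Nat.le_of_dvd hn (Int.natCast_dvd_natCast.1 ⟨_, hnl⟩)

/-! ### The quasi-polynomial and its constant coefficient. -/

/-- This splits off k full periods of length c. Applied with n = rC and period lC, it isolates the
part of the floor sum that depends on r = m mod l only. -/
theorem two_mul_sum_ediv_add (a : ℤ) {c : ℕ} (hc : 0 < c) (hac : IsCoprime a (c : ℤ)) (k n : ℕ) :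
    2 * ∑ y ∈ Finset.range (k * c + n + 1), a * y / (c : ℤ)
      = a * k * (k * c + 1) - k * c + k
        + 2 * (n * (a * k) + ∑ y ∈ Finset.range (n + 1), a * y / (c : ℤ)) := by
  have hE := two_mul_sum_ediv a c k (Or.inl hc)
  rw [Int.isCoprime_iff_gcd_eq_one.1 hac] at hE
  have hc' : (c : ℤ) ≠ 0 := by exact_mod_cast hc.ne'
  have : ∀ y ∈ Finset.range n, a * ((k * c + 1 + y : ℕ) : ℤ) / (c : ℤ)
      = a * k + a * ((y + 1 : ℕ) : ℤ) / (c : ℤ) := by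
    intro y _
    rw [show a * ((k * c + 1 + y : ℕ) : ℤ) = a * ((y + 1 : ℕ) : ℤ) + (a * k) * c by
      push_cast; ring, Int.add_mul_ediv_right _ _ hc', add_comm]
  rw [show k * c + n + 1 = (k * c + 1) + n by ring, Finset.sum_range_add, mul_add, hE,
    Finset.sum_congr rfl this, Finset.sum_add_distrib, Finset.sum_range_succ' _ n]
  simp

/-- The constant coefficient of the lattice point enumerator, `r` being the residue of `m`
modulo `l`. -/
noncomputable def constCoeff (l C : ℕ) (A : ℤ) (r : ℕ) : ℝ :=
  1 - (1 + l * A) * r * (r * C + 1) / (2 * l)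
    + ((∑ y ∈ Finset.range (r * C + 1), (1 + l * A) * y / ((l : ℤ) * C) : ℤ) : ℝ)
    + r * (l * C - 1) / (2 * l)

/-- The coefficients of the lattice point enumerator of a triangle with denominator `l`. -/
noncomputable def triangleCoeffs (l C : ℕ) (A : ℤ) (i : Fin 3) (m : ℕ) : ℝ :=
  ![constCoeff l C A (m % l),
    ((C : ℝ) - A + Int.gcd A C) / 2 + ((1 + l * A) - l * C + 1) / (2 * l), C / (2 * l)] i

theorem isEhrhartCoeffs_triangle (δ : SL(2, ℤ)) (l C : ℕ) (A : ℤ) (hl : 0 < l) (hC : 0 < C)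
    (ha : δ 0 0 = 1 + l * A) (hc : δ 1 0 = l * C) :
    IsEhrhartCoeffs ((l : ℝ)⁻¹ • triangle δ) (triangleCoeffs l C A) := by
  have hden := den_triangle δ l C hl hC hc
  have hcop : IsCoprime (1 + l * A) ((l * C : ℕ) : ℤ) := by
    have hdet := δ.det_coe
    rw [Matrix.det_fin_two, ha, hc] at hdet
    exact ⟨δ 1 1, -δ 0 1, by push_cast; linear_combination hdet⟩
  refine ⟨by rw [hden]; exact hl, fun i m => by simp [hden, triangleCoeffs], fun m => ?_⟩
  have hN := ncard_base l C m A hl hC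
  rw [← latticeCount_triangle δ l C A hl hC ha hc, Finset.sum_add_distrib, Finset.sum_add_distrib,
    sum_left_edge l C m A hl hC] at hN
  have hE := two_mul_sum_ediv A C m (Or.inl hC)
  have hF := two_mul_sum_ediv_add (1 + l * A) (Nat.mul_pos hl hC) hcop (m / l) (m % l * C)
  have hm := Nat.div_add_mod m l
  rw [show m / l * (l * C) + m % l * C + 1 = m * C + 1 by
    nth_rewrite 3 [← hm]; ring] at hF
  simp only [triangleCoeffs, constCoeff, Matrix.cons_val_zero, Matrix.cons_val_one,
    Matrix.cons_val]
  simp only [Nat.cast_mul] at hF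
  set k := m / l
  set r := m % l
  set F := ∑ y ∈ Finset.range (r * C + 1), (1 + l * A) * y / ((l : ℤ) * C)
  have hG : 2 * (latticeCount ((l : ℝ)⁻¹ • triangle δ) m : ℤ)
      = A * m * (m * C + 1) - m * C + m * Int.gcd A C - 2 * ((m * C + 1) * (m * A))
        + ((1 + l * A) * k * (k * (l * C) + 1) - k * (l * C) + k
          + 2 * (r * C * ((1 + l * A) * k) + F)) + 2 * (m * C + 1) := by
    rw [hN, mul_add, mul_add, mul_add, hE, hF]
    simp
    ring
  have hG' : 2 * (latticeCount ((l : ℝ)⁻¹ • triangle δ) m : ℝ)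
      = A * m * (m * C + 1) - m * C + m * Int.gcd A C - 2 * ((m * C + 1) * (m * A))
        + ((1 + l * A) * k * (k * (l * C) + 1) - k * (l * C) + k
          + 2 * (r * C * ((1 + l * A) * k) + F)) + 2 * (m * C + 1) := by
    exact_mod_cast hG
  have hl' : (l : ℝ) ≠ 0 := by positivity
  -- Substituting k = (m - r)/l turns the count into a polynomial in m whose r-dependence sits in
  -- the constant term.
  have hk : (k : ℝ) = (m - r) / l := by
    rw [eq_div_iff hl']
    have : (l : ℝ) * k + r = m := by exact_mod_cast hm
    linarith
  rw [hk] at hG'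
  rw [eq_comm, ← mul_right_inj' (two_ne_zero (α := ℝ)), hG']
  generalize (F : ℝ) = F
  field_simp
  ring

theorem constCoeff_reciprocity (l C₁ C C₂ r : ℕ) (A₁ A b d A₂ : ℤ) (hr : r < l)
    (hC₁ : 0 < C₁) (hC : 0 < C) (hC₂pos : 0 < C₂)
    (hdet : (1 + l * A₁) * d - b * (l * C₁) = 1)
    (hA₂ : A₂ = A₁ + A + l * A₁ * A + b * C) (hC₂ : (C₂ : ℤ) = C₁ * (1 + l * A) + d * C) :
    constCoeff l C₂ A₂ r = constCoeff l C₁ A₁ r + constCoeff l C A r + (r : ℝ) / l - 1 := by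
  have hl' : (l : ℝ) ≠ 0 := by
    have : 0 < l := by omega
    positivity
  have h := floor_sum_reciprocity l C₁ C C₂ r A₁ A b d A₂ hr hC₁ hC hC₂pos hdet hA₂ hC₂
  -- This form of the determinant relation cancels the terms quadratic in r.
  have hdet' : (C₂ : ℤ) - C₁ - C = l * (A₂ * C₁ - A₁ * C₂) := by
    rw [hA₂, hC₂]
    linear_combination (C : ℤ) * hdet
  have hdetR : (C₂ : ℝ) - C₁ - C = l * (A₂ * C₁ - A₁ * C₂) := by exact_mod_cast hdet'
  unfold constCoeff
  generalize (∑ y ∈ Finset.range (r * C₂ + 1), (1 + l * A₂) * y / ((l : ℤ) * C₂)) = F₂ at *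
  generalize (∑ y ∈ Finset.range (r * C₁ + 1), (1 + l * A₁) * y / ((l : ℤ) * C₁)) = F₁ at *
  generalize (∑ y ∈ Finset.range (r * C + 1), (1 + l * A) * y / ((l : ℤ) * C)) = F at *
  have hR : 2 * ((F₂ : ℝ) - F₁ - F)
      = -(A * r * (r * C + 1)) + r * C + 2 * ((r * C₂ + 1) * (r * (A₂ - A₁)))
        - ((A₂ - A₁) * r * (r * (C₂ - C₁) + 1) + r * (C₂ - C₁)) := by exact_mod_cast h
  have hF : (F₂ : ℝ) = F₁ + F + (-(A * r * (r * C + 1)) + r * C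
      + 2 * ((r * C₂ + 1) * (r * (A₂ - A₁)))
        - ((A₂ - A₁) * r * (r * (C₂ - C₁) + 1) + r * (C₂ - C₁))) / 2 := by linarith
  rw [hF]
  field_simp
  linear_combination (-(r : ℝ) ^ 2) * hdetR

end EhrhartTriangle


theorem theorem3 (γ γ' : SL(2, ℤ)) (hc : 0 < γ 1 0) (hc' : 0 < γ' 1 0)
    (hcc' : 0 < γ 1 0 * γ' 0 0 + γ 1 1 * γ' 1 0)
    (ℓ : ℕ) (hℓ : ℓ = Nat.gcd (EhrhartTriangle.content γ) (EhrhartTriangle.content γ')) :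
    (∀ δ ∈ ({γ, γ', γ * γ'} : Set SL(2, ℤ)),
      EhrhartTriangle.IsEhrhartCoeffs ((ℓ : ℝ)⁻¹ • EhrhartTriangle.triangle δ)
        (EhrhartTriangle.ehrhartCoeff ((ℓ : ℝ)⁻¹ • EhrhartTriangle.triangle δ))) ∧
    ∀ m : ℕ,
      EhrhartTriangle.ehrhartCoeff ((ℓ : ℝ)⁻¹ • EhrhartTriangle.triangle (γ * γ')) 0 m =
        EhrhartTriangle.ehrhartCoeff ((ℓ : ℝ)⁻¹ • EhrhartTriangle.triangle γ) 0 m +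
        EhrhartTriangle.ehrhartCoeff ((ℓ : ℝ)⁻¹ • EhrhartTriangle.triangle γ') 0 m +
        Int.fract ((m : ℝ) / (ℓ : ℝ)) - 1 := by
  open EhrhartTriangle in
  have hd₁ : (ℓ : ℤ) ∣ content γ := by rw [hℓ]; exact_mod_cast Nat.gcd_dvd_left _ _
  have hd₂ : (ℓ : ℤ) ∣ content γ' := by rw [hℓ]; exact_mod_cast Nat.gcd_dvd_right _ _
  obtain ⟨C₁, hC₁⟩ := hd₁.trans (Int.gcd_dvd_left _ _)
  obtain ⟨A₁, hA₁⟩ := hd₁.trans (Int.gcd_dvd_right _ _)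
  obtain ⟨C, hC⟩ := hd₂.trans (Int.gcd_dvd_left _ _)
  obtain ⟨A, hA⟩ := hd₂.trans (Int.gcd_dvd_right _ _)
  -- ℓ = 0 would force c = 0.
  have hl : 0 < ℓ := by
    refine Nat.pos_of_ne_zero fun h => ?_
    simp [h] at hC₁
    omega
  have hl' : (0 : ℤ) < ℓ := by exact_mod_cast hl
  have ha₁ : γ 0 0 = 1 + ℓ * A₁ := by linarith
  have ha : γ' 0 0 = 1 + ℓ * A := by linarith
  have hC₁pos : 0 < C₁ := pos_of_mul_pos_right (hC₁ ▸ hc) hl'.le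
  have hCpos : 0 < C := pos_of_mul_pos_right (hC ▸ hc') hl'.le
  have hdet := γ.det_coe
  rw [Matrix.det_fin_two, ha₁, hC₁] at hdet
  have hC₂ : (γ * γ') 1 0 = ℓ * (C₁ * (1 + ℓ * A) + γ 1 1 * C) := by
    simp only [Matrix.SpecialLinearGroup.coe_mul, Matrix.mul_apply, Fin.sum_univ_two]
    rw [hC₁, ha, hC]
    ring
  have hA₂ : (γ * γ') 0 0 = 1 + ℓ * (A₁ + A + ℓ * A₁ * A + γ 0 1 * C) := by
    simp only [Matrix.SpecialLinearGroup.coe_mul, Matrix.mul_apply, Fin.sum_univ_two]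
    rw [ha₁, ha, hC]
    ring
  have hC₂pos : 0 < C₁ * (1 + ℓ * A) + γ 1 1 * C := by
    refine pos_of_mul_pos_right (a := (ℓ : ℤ)) ?_ hl'.le
    rw [hC₁, ha, hC] at hcc'
    linarith
  lift C₁ to ℕ using hC₁pos.le
  lift C to ℕ using hCpos.le
  obtain ⟨C₂, hC₂'⟩ := Int.eq_ofNat_of_zero_le hC₂pos.le
  rw [hC₂'] at hC₂ hC₂pos
  have hC₁pos : 0 < C₁ := by exact_mod_cast hC₁pos
  have hCpos : 0 < C := by exact_mod_cast hCpos
  have hC₂pos : 0 < C₂ := by exact_mod_cast hC₂pos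
  have h₁ := isEhrhartCoeffs_triangle γ ℓ C₁ A₁ hl hC₁pos ha₁ hC₁
  have h := isEhrhartCoeffs_triangle γ' ℓ C A hl hCpos ha hC
  have h₂ := isEhrhartCoeffs_triangle (γ * γ') ℓ C₂ _ hl hC₂pos hA₂ hC₂
  refine ⟨?_, fun m => ?_⟩
  · rintro δ (rfl | rfl | rfl)
    · rwa [h₁.ehrhartCoeff_eq]
    · rwa [h.ehrhartCoeff_eq]
    · rwa [h₂.ehrhartCoeff_eq]
  · rw [h₁.ehrhartCoeff_eq, h.ehrhartCoeff_eq, h₂.ehrhartCoeff_eq, Int.fract_div_natCast_eq_div_natCast_mod]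
    -- The constant coefficients depend on m mod ℓ only, which supplies the bound r < ℓ needed for
    -- the right edge.
    exact constCoeff_reciprocity ℓ C₁ C C₂ (m % ℓ) A₁ A (γ 0 1) (γ 1 1) _ (Nat.mod_lt _ hl)
      hC₁pos hCpos hC₂pos (by linear_combination hdet) rfl hC₂'.symm
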